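/- Consider online $b$-matching with stochastic rewards. An input $G$ consists of a finite set $S$ of servers, known in advance, each of which can be matched at most $b$ times, and a finite sequence $R$ of requests arriving one by one. When $r\in R$ arrives, its incident edges $\{s,r\}\in E$ and their success probabilities $p_{s,r}\in[0,1]$ are revealed, and a (randomized) online algorithm, knowing only what has been observed so far, irrevocably assigns $r$ to a neighbor with remaining capacity or leaves it unassigned. An assignment of $r$ to $s$ becomes a match with probability $p_{s,r}$, independently of the past; otherwise $r$ leaves and the remaining capacity of $s$ is unchanged. The algorithm learns the outcome after the assignment. Let $\mathbb{E}[\mathrm{Alg}(G)]$ be the expected number of matches. Let $\mathrm{Opt}(G)$ be the optimum of the fractional budgeted allocation problem $$\max \sum_{\{s,r\}\in E} p_{s,r}\,m(s,r)\quad\text{s.t.}\quad \sum_{r:\{s,r\}\in E} p_{s,r}\,m(s,r)\le b\ (s\in S),\quad \sum_{s:\{s,r\}\in E} m(s,r)\le 1\ (r\in R),\quad m\ge 0 .$$ An algorithm is $c$-competitive against $\mathrm{Opt}$ on a class of inputs if $\mathbb{E}[\mathrm{Alg}(G)]\ge c\cdot \mathrm{Opt}(G)$ for all $G$ in the class. Then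 for every integer $b\ge 1$, no randomized online algorithm achieves a competitive ratio greater than $1-1/e$ against $\mathrm{Opt}$, even for equal and vanishing edge probabilities: for every $b\ge1$ and every $c>1-1/e$ there is $p_0>0$ such that for every $p\in(0,p_0)$ no randomized online algorithm (even one designed for these $b$, $c$ and $p$) is $c$-competitive against $\mathrm{Opt}$ on the class of inputs in which every edge has success probability $p$. -/

import Mathlib

open Filter Topology
open scoped ENNReal

noncomputable section

namespace OnlineBMatching

/-- A request, as revealed on arrival: `r s = some q` means that there is an edge to server `s`
with success probability `q`; `r s = none` means that there is no edge to `s`. -/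
abbrev Request (n : ℕ) : Type := Fin n → Option unitInterval

/-- An input: a bipartite graph with `numServers` servers and `numRequests` requests, which arrive
in the order of their indices, together with the success probabilities of the edges. -/
structure Input where
  numServers : ℕ
  numRequests : ℕ
  request : Fin numRequests → Request numServers

/-- What is recorded about one arrival: the request, the server chosen by the algorithm
(`none` if the request is left unassigned), and whether the assignment succeeded. -/
structure Step (n : ℕ) where
  request : Request n
  choice : Option (Fin n)
  success : Bool

/-- The history of the arrivals so far, most recent one first. -/
abbrev History (n : ℕ) : Type := List (Step n)

/-- A randomized online algorithm. The set of servers is known in advance. When a request arrives,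
the algorithm draws a server (or `none`) from a distribution that may depend on everything observed
so far: the earlier requests with their edges and probabilities, the algorithm's own earlier random
choices, the outcomes of the earlier assignments, and the current request. Nothing about later
requests, including their number, is available. -/
abbrev Algorithm : Type := (n : ℕ) → History n → Request n → PMF (Option (Fin n))

/-- The number of times that server `s` has been matched. -/
def matchesOf {n : ℕ} (h : History n) (s : Fin n) : ℕ :=
  h.countP fun t => t.choice = some s ∧ t.success = true

/-- The total number of matches. -/
def totalMatches {n : ℕ} (h : History n) : ℕ :=
  h.countP fun t => t.success

/-- A coin that shows `true` with probability `q`. -/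
def coin (q : unitInterval) : PMF Bool :=
  PMF.ofFintype (fun x => ENNReal.ofReal (if x then (q : ℝ) else 1 - q)) (by
    rw [Fintype.sum_bool, if_pos rfl, if_neg Bool.false_ne_true,
      ← ENNReal.ofReal_add q.2.1 (sub_nonneg.2 q.2.2)]
    simp)

/-- The law of the outcome of choosing `a` for the request `r` after the history `h`, when servers
have capacity `b`: the assignment to a neighbor `s` with remaining capacity succeeds with the
probability of the edge. Choosing a server that is not eligible amounts to no assignment. -/
def outcome (b : ℕ) {n : ℕ} (h : History n) (r : Request n) : Option (Fin n) → PMF Bool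
  | none => PMF.pure false
  | some s =>
    match r s with
    | none => PMF.pure false
    | some q => if matchesOf h s < b then coin q else PMF.pure false

/-- The law of the final history, when the requests in the list arrive after the history `h`.
The outcomes of assignments are independent of past ones. -/
def play (b : ℕ) {n : ℕ} (A : History n → Request n → PMF (Option (Fin n))) :
    List (Request n) → History n → PMF (History n)
  | [], h => PMF.pure h
  | r :: rs, h =>
    (A h r).bind fun a => (outcome b h r a).bind fun x => play b A rs (⟨r, a, x⟩ :: h)

/-- The law of the number of matches of the algorithm `A` on the input `G`. -/
def matchLaw (b : ℕ) (A : Algorithm) (G : Input) : PMF ℕ :=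
  (play b (A G.numServers) (List.ofFn G.request) []).map totalMatches

/-- The expected number of matches of the algorithm `A` on the input `G`. (The sum is finite, since
the number of matches is at most the number of requests.) -/
def expectedMatches (b : ℕ) (A : Algorithm) (G : Input) : ℝ :=
  (∑' k : ℕ, matchLaw b A G k * (k : ℝ≥0∞)).toReal

namespace Input

/-- `{s, r}` is an edge. -/
def IsEdge (G : Input) (s : Fin G.numServers) (r : Fin G.numRequests) : Prop :=
  (G.request r s).isSome

/-- The success probability of the edge `{s, r}` (and `0` if there is no such edge). -/
def prob (G : Input) (s : Fin G.numServers) (r : Fin G.numRequests) : ℝ :=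
  (G.request r s).elim 0 fun q => (q : ℝ)

open Classical in
/-- Fractional solutions of the budgeted allocation problem with budgets `b`. -/
structure IsFeasible (b : ℕ) (G : Input) (m : Fin G.numServers → Fin G.numRequests → ℝ) :
    Prop where
  nonneg : ∀ s r, G.IsEdge s r → 0 ≤ m s r
  capacity : ∀ s, ∑ r with G.IsEdge s r, G.prob s r * m s r ≤ b
  assigned : ∀ r, ∑ s with G.IsEdge s r, m s r ≤ 1

open Classical in
/-- The total reward of a fractional solution. -/
def reward (G : Input) (m : Fin G.numServers → Fin G.numRequests → ℝ) : ℝ :=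
  ∑ s, ∑ r with G.IsEdge s r, G.prob s r * m s r

/-- The non-stochastic benchmark: the optimum of the fractional budgeted allocation problem.
(The set of rewards contains `0` and is bounded by `b` times the number of servers.) -/
def opt (b : ℕ) (G : Input) : ℝ :=
  sSup {v | ∃ m, IsFeasible b G m ∧ v = G.reward m}

/-- All edges have the same success probability `p`. -/
def HasEqualProb (p : ℝ) (G : Input) : Prop :=
  ∀ s r, G.IsEdge s r → G.prob s r = p

end Input

/-- The algorithm `A` is `c`-competitive against the non-stochastic benchmark on the class `𝒢` of
inputs, for server capacity `b`. -/
def IsCompetitiveOn (𝒢 : Set Input) (b : ℕ) (c : ℝ) (A : Algorithm) : Prop :=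
  ∀ G ∈ 𝒢, c * G.opt b ≤ expectedMatches b A G

end OnlineBMatching

end

/-!
The hard inputs are upper triangular: the servers carry ranks `0, …, n - 1`, the requests arrive in
`n` blocks of `⌊b / p⌋` requests of decreasing level, and a request of level `l` is adjacent to the
`l + 1` servers of rank at most `l`. Sending every block to the server whose rank is its level
almost exhausts all budgets, so `Opt` is about `n * b`. Now average over all rankings.
Until level `l` has passed, an online algorithm cannot tell the servers of rank at most `l` apart,
so a request of that level is matched to each of them with the same probability, at most
`p / (l + 1)`. Hence the server of rank `k` receives on average at most `b * min 1 (H_n - H_k)`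
matches, where `H` denotes the harmonic numbers. As `H_n - H_k` exceeds `1` once `k < n / e`
approximately, these bounds add up to about `(1 - 1 / e) * n * b`.
-/

open scoped BigOperators

namespace OnlineBMatching

section Mean

variable {α β ι : Type*}

/-- The expectation of a `[0, ∞]`-valued function under a discrete law. -/
noncomputable def mean (μ : PMF α) (f : α → ℝ≥0∞) : ℝ≥0∞ := ∑' a, μ a * f a

theorem mean_pure (a : α) (f : α → ℝ≥0∞) : mean (PMF.pure a) f = f a := by
  classical
  simp [mean, PMF.pure_apply]

theorem mean_bind (μ : PMF α) (κ : α → PMF β) (f : β → ℝ≥0∞) :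
    mean (μ.bind κ) f = mean μ fun a => mean (κ a) f := by
  simp_rw [mean, PMF.bind_apply, ← ENNReal.tsum_mul_right, ← ENNReal.tsum_mul_left, mul_assoc]
  exact ENNReal.tsum_comm

theorem mean_map (μ : PMF α) (g : α → β) (f : β → ℝ≥0∞) :
    mean (μ.map g) f = mean μ (f ∘ g) := by
  simp only [PMF.map, mean_bind, mean_pure, Function.comp_def]

theorem mean_add (μ : PMF α) (f g : α → ℝ≥0∞) :
    mean μ (fun a => f a + g a) = mean μ f + mean μ g := by
  simp only [mean, mul_add, ENNReal.tsum_add]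

theorem mean_sum (μ : PMF α) (s : Finset ι) (f : ι → α → ℝ≥0∞) :
    mean μ (fun a => ∑ i ∈ s, f i a) = ∑ i ∈ s, mean μ (f i) := by
  simp only [mean, Finset.mul_sum]
  exact Summable.tsum_finsetSum fun _ _ => ENNReal.summable

theorem mean_const (μ : PMF α) (c : ℝ≥0∞) : mean μ (fun _ => c) = c := by
  rw [mean, ENNReal.tsum_mul_right, μ.tsum_coe, one_mul]

theorem mean_le_of_forall_mem_support {μ : PMF α} {f : α → ℝ≥0∞} {c : ℝ≥0∞}
    (h : ∀ a ∈ μ.support, f a ≤ c) : mean μ f ≤ c := by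
  rw [← mean_const μ c]
  refine ENNReal.tsum_le_tsum fun a => ?_
  by_cases ha : a ∈ μ.support
  · gcongr
    exact h a ha
  · simp [(μ.apply_eq_zero_iff a).2 ha]

theorem mean_ite_eq [DecidableEq α] (μ : PMF α) (a : α) (c : ℝ≥0∞) :
    mean μ (fun x => if x = a then c else 0) = μ a * c := by
  simp [mean]

end Mean

section Play

variable {n : ℕ} (b : ℕ) (A : History n → Request n → PMF (Option (Fin n)))

theorem mean_play_concat (rs : List (Request n)) (r : Request n) (h : History n)
    (f : History n → ℝ≥0∞) :
    mean (play b A (rs.concat r) h) f = mean (play b A rs h) fun h' =>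
      mean (A h' r) fun a => mean (outcome b h' r a) fun x => f (⟨r, a, x⟩ :: h') := by
  induction rs generalizing h with
  | nil => simp only [List.concat_nil, play, mean_bind, mean_pure]
  | cons r' rs ih => simp only [List.concat_cons, play, mean_bind, ih]

theorem matchesOf_cons (h : History n) (r : Request n) (a : Option (Fin n)) (x : Bool)
    (s : Fin n) :
    matchesOf (⟨r, a, x⟩ :: h) s = matchesOf h s + if a = some s ∧ x = true then 1 else 0 := by
  simp [matchesOf, List.countP_cons]

theorem totalMatches_cons (h : History n) (r : Request n) (a : Option (Fin n)) (x : Bool) :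
    totalMatches (⟨r, a, x⟩ :: h) = totalMatches h + if x = true then 1 else 0 := by
  simp [totalMatches, List.countP_cons]

variable {b} in
theorem matchesOf_lt_of_true_mem_support_outcome {h : History n} {r : Request n} {s : Fin n}
    (hx : true ∈ (outcome b h r (some s)).support) : matchesOf h s < b := by
  by_contra hlt
  cases hr : r s <;> simp [outcome, hr, hlt] at hx

variable {b A} in
theorem matchesOf_le_of_mem_support_play {rs : List (Request n)} {s : Fin n} {h h' : History n}
    (hh : matchesOf h s ≤ b) (hh' : h' ∈ (play b A rs h).support) : matchesOf h' s ≤ b := by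
  induction rs generalizing h with
  | nil => simp_all [play]
  | cons r rs ih =>
    simp only [play, PMF.mem_support_bind_iff] at hh'
    obtain ⟨a, -, x, hx, hh'⟩ := hh'
    refine ih ?_ hh'
    rw [matchesOf_cons]
    split_ifs with hax
    · obtain ⟨rfl, rfl⟩ := hax
      exact matchesOf_lt_of_true_mem_support_outcome hx
    · exact hh

theorem outcome_some_true_le (h : History n) (r : Request n) (s : Fin n) :
    outcome b h r (some s) true ≤ ENNReal.ofReal ((r s).elim 0 fun q => (q : ℝ)) := by
  cases hr : r s with
  | none => simp [outcome, hr]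
  | some q =>
    by_cases hlt : matchesOf h s < b <;> simp [outcome, hr, hlt, coin]

/-- The probability that the request `r`, arriving after the requests `rs`, is matched to `s`. -/
noncomputable def matchProbAfter (rs : List (Request n)) (r : Request n) (s : Fin n) : ℝ≥0∞ :=
  mean (play b A rs []) fun h => A h r (some s) * outcome b h r (some s) true

theorem mean_matchesOf_concat (rs : List (Request n)) (r : Request n) (s : Fin n) :
    mean (play b A (rs.concat r) []) (fun h => (matchesOf h s : ℝ≥0∞)) =
      mean (play b A rs []) (fun h => (matchesOf h s : ℝ≥0∞)) + matchProbAfter b A rs r s := by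
  rw [mean_play_concat, matchProbAfter, ← mean_add]
  congr! 2 with h
  simp only [matchesOf_cons, Nat.cast_add, Nat.cast_ite, Nat.cast_one, Nat.cast_zero, mean_add,
    mean_const]
  rw [← mean_ite_eq]
  congr! 3 with a
  by_cases ha : a = some s
  · simp [ha, mean_ite_eq]
  · simp [ha, mean_const]

theorem mean_totalMatches_concat (rs : List (Request n)) (r : Request n) :
    mean (play b A (rs.concat r) []) (fun h => (totalMatches h : ℝ≥0∞)) =
      mean (play b A rs []) (fun h => (totalMatches h : ℝ≥0∞)) +
        ∑ s, matchProbAfter b A rs r s := by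
  simp only [matchProbAfter]
  rw [mean_play_concat, ← mean_sum, ← mean_add]
  congr! 2 with h
  simp only [totalMatches_cons, Nat.cast_add, Nat.cast_ite, Nat.cast_one, Nat.cast_zero, mean_add,
    mean_const, mean_ite_eq, mul_one]
  simp [mean, tsum_fintype, Fintype.sum_option, outcome]

theorem mean_matchesOf_play_ofFn {N : ℕ} (ρ : Fin N → Request n) (s : Fin n) :
    mean (play b A (List.ofFn ρ) []) (fun h => (matchesOf h s : ℝ≥0∞)) =
      ∑ r : Fin N, matchProbAfter b A (List.ofFn (Fin.take r r.is_lt.le ρ)) (ρ r) s := by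
  induction N with
  | zero => simp [play, mean_pure, matchesOf]
  | succ N ih =>
    rw [List.ofFn_succ', mean_matchesOf_concat, ih, Fin.sum_univ_castSucc]
    rfl

theorem mean_totalMatches_play_ofFn {N : ℕ} (ρ : Fin N → Request n) :
    mean (play b A (List.ofFn ρ) []) (fun h => (totalMatches h : ℝ≥0∞)) =
      ∑ r : Fin N, ∑ s, matchProbAfter b A (List.ofFn (Fin.take r r.is_lt.le ρ)) (ρ r) s := by
  induction N with
  | zero => simp [play, mean_pure, totalMatches]
  | succ N ih =>
    rw [List.ofFn_succ', mean_totalMatches_concat, ih, Fin.sum_univ_castSucc]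
    rfl

theorem sum_matchProbAfter_le {p : ℝ} (rs : List (Request n)) {r : Request n}
    (hr : ∀ s, (r s).elim 0 (fun q => (q : ℝ)) ≤ p) :
    ∑ s, matchProbAfter b A rs r s ≤ ENNReal.ofReal p := by
  simp only [matchProbAfter]
  rw [← mean_sum]
  refine mean_le_of_forall_mem_support fun h _ => ?_
  have hA : ∑ s, A h r (some s) ≤ 1 := by
    rw [← (A h r).tsum_coe, tsum_fintype, Fintype.sum_option]
    exact le_add_self
  calc ∑ s, A h r (some s) * outcome b h r (some s) true
      ≤ ∑ s, A h r (some s) * ENNReal.ofReal p := by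
        gcongr with s
        exact (outcome_some_true_le b h r s).trans (ENNReal.ofReal_le_ofReal (hr s))
    _ = (∑ s, A h r (some s)) * ENNReal.ofReal p := (Finset.sum_mul ..).symm
    _ ≤ ENNReal.ofReal p := mul_le_of_le_one_left' hA

theorem matchProbAfter_ne_top (rs : List (Request n)) (r : Request n) (s : Fin n) :
    matchProbAfter b A rs r s ≠ ∞ := by
  refine ne_top_of_le_ne_top ENNReal.one_ne_top (mean_le_of_forall_mem_support fun h _ => ?_)
  exact mul_le_one' (PMF.coe_le_one _ _) (PMF.coe_le_one _ _)

end Play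

namespace Input

theorem not_isEdge_iff {G : Input} {s : Fin G.numServers} {r : Fin G.numRequests} :
    ¬ G.IsEdge s r ↔ G.request r s = none := by
  simp [IsEdge]

section MatchProb

variable (b : ℕ) (A : Algorithm) (G : Input)

/-- The probability that the algorithm `A` matches the request `r` of the input `G` to the
server `s`. -/
noncomputable def matchProb (r : Fin G.numRequests) (s : Fin G.numServers) : ℝ :=
  (matchProbAfter b (A G.numServers) (List.ofFn (Fin.take r r.is_lt.le G.request))
    (G.request r) s).toReal

theorem matchProb_nonneg (r : Fin G.numRequests) (s : Fin G.numServers) :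
    0 ≤ G.matchProb b A r s :=
  ENNReal.toReal_nonneg

variable {G} in
theorem matchProb_eq_zero {r : Fin G.numRequests} {s : Fin G.numServers} (h : ¬ G.IsEdge s r) :
    G.matchProb b A r s = 0 := by
  simp [matchProb, matchProbAfter, outcome, not_isEdge_iff.1 h, mean_const]

variable {G} in
theorem sum_matchProb_le {p : ℝ} (hp : 0 ≤ p) {r : Fin G.numRequests}
    (hr : ∀ s, G.prob s r ≤ p) : ∑ s, G.matchProb b A r s ≤ p := by
  simp only [matchProb]
  rw [← ENNReal.toReal_sum fun _ _ => matchProbAfter_ne_top _ _ _ _ _]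
  exact ENNReal.toReal_le_of_le_ofReal hp (sum_matchProbAfter_le b _ _ hr)

theorem sum_matchProb_le_capacity (s : Fin G.numServers) : ∑ r, G.matchProb b A r s ≤ b := by
  simp only [matchProb]
  rw [← ENNReal.toReal_sum fun _ _ => matchProbAfter_ne_top _ _ _ _ _, ← mean_matchesOf_play_ofFn]
  refine ENNReal.toReal_le_of_le_ofReal b.cast_nonneg ?_
  rw [ENNReal.ofReal_natCast]
  refine mean_le_of_forall_mem_support fun h hh => ?_
  exact_mod_cast matchesOf_le_of_mem_support_play (by simp [matchesOf]) hh

theorem expectedMatches_eq_sum_matchProb :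
    expectedMatches b A G = ∑ r, ∑ s, G.matchProb b A r s := by
  have hmean : expectedMatches b A G =
      (mean (play b (A G.numServers) (List.ofFn G.request) []) fun h => totalMatches h).toReal :=
    congrArg ENNReal.toReal (mean_map _ _ fun k : ℕ => (k : ℝ≥0∞))
  rw [hmean, mean_totalMatches_play_ofFn,
    ENNReal.toReal_sum fun _ _ => ENNReal.sum_ne_top.2 fun _ _ => matchProbAfter_ne_top _ _ _ _ _]
  exact Finset.sum_congr rfl fun _ _ =>
    ENNReal.toReal_sum fun _ _ => matchProbAfter_ne_top _ _ _ _ _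

theorem matchProb_congr {n N : ℕ} {ρ ρ' : Fin N → Request n} {r : Fin N}
    (h : ∀ i ≤ r, ρ i = ρ' i) (s : Fin n) :
    matchProb b A ⟨n, N, ρ⟩ r s = matchProb b A ⟨n, N, ρ'⟩ r s := by
  have htake : Fin.take r r.is_lt.le ρ = Fin.take r r.is_lt.le ρ' :=
    funext fun i => h _ (Fin.le_def.2 i.is_lt.le)
  simp only [matchProb, htake, h r le_rfl]

end MatchProb

section Opt

variable {b : ℕ} {G : Input}

theorem IsFeasible.reward_le_opt {m : Fin G.numServers → Fin G.numRequests → ℝ}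
    (hm : IsFeasible b G m) : G.reward m ≤ G.opt b := by
  refine le_csSup ⟨∑ _ : Fin G.numServers, (b : ℝ), ?_⟩ ⟨m, hm, rfl⟩
  rintro v ⟨m', hm', rfl⟩
  exact Finset.sum_le_sum fun s _ => hm'.capacity s

open Classical in
theorem sum_prob_le_opt (f : Fin G.numRequests → Fin G.numServers)
    (hf : ∀ s, ∑ r with f r = s, G.prob s r ≤ b) : ∑ r, G.prob (f r) r ≤ G.opt b := by
  let m : Fin G.numServers → Fin G.numRequests → ℝ := fun s r => if f r = s then 1 else 0
  have hm : ∀ s r, 0 ≤ m s r := fun s r => by positivity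
  have hserver (s) : ∑ r with G.IsEdge s r, G.prob s r * m s r = ∑ r with f r = s, G.prob s r := by
    have hprob : ∀ r, G.prob s r * m s r ≠ 0 → G.IsEdge s r := by
      intro r hr
      contrapose hr
      simp [prob, not_isEdge_iff.1 hr]
    rw [Finset.sum_filter_of_ne fun r _ => hprob r, Finset.sum_filter]
    simp [m]
  have hfeasible : IsFeasible b G m := by
    refine ⟨fun s r _ => hm s r, fun s => (hserver s).trans_le (hf s), fun r => ?_⟩
    calc ∑ s with G.IsEdge s r, m s r ≤ ∑ s, m s r :=
          Finset.sum_le_univ_sum_of_nonneg fun s => hm s r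
      _ = 1 := by simp [m]
  calc ∑ r, G.prob (f r) r = ∑ s, ∑ r with f r = s, G.prob (f r) r :=
        (Finset.sum_fiberwise _ _ _).symm
    _ = ∑ s, ∑ r with f r = s, G.prob s r :=
        Finset.sum_congr rfl fun s _ => Finset.sum_congr rfl fun r hr => by
          rw [(Finset.mem_filter.1 hr).2]
    _ = G.reward m := Finset.sum_congr rfl fun s _ => (hserver s).symm
    _ ≤ G.opt b := hfeasible.reward_le_opt

end Opt

end Input

section Harmonic

theorem sum_Ici_inv_eq_harmonic_sub {n : ℕ} (k : Fin n) :
    ∑ l ∈ Finset.Ici k, ((l : ℝ) + 1)⁻¹ = harmonic n - harmonic k := by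
  calc ∑ l ∈ Finset.Ici k, ((l : ℝ) + 1)⁻¹
      = ∑ i ∈ (Finset.Ici k).map Fin.valEmbedding, ((i : ℝ) + 1)⁻¹ :=
        (Finset.sum_map _ Fin.valEmbedding fun i : ℕ => ((i : ℝ) + 1)⁻¹).symm
    _ = harmonic n - harmonic k := by
      rw [Fin.map_valEmbedding_Ici, Finset.sum_Ico_eq_sub _ k.is_le']
      simp [harmonic]

theorem tendsto_harmonic_sub_harmonic_floor {a : ℝ} (ha : 0 < a) :
    Tendsto (fun n : ℕ => (harmonic n : ℝ) - harmonic ⌊a * n⌋₊) atTop (𝓝 (-Real.log a)) := by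
  have hfloor : Tendsto (fun n : ℕ => ⌊a * n⌋₊) atTop atTop :=
    tendsto_nat_floor_atTop.comp (tendsto_natCast_atTop_atTop.const_mul_atTop ha)
  have hratio : Tendsto (fun n : ℕ => Real.log (⌊a * n⌋₊ / n)) atTop (𝓝 (Real.log a)) :=
    ((tendsto_nat_floor_mul_div_atTop ha.le).comp tendsto_natCast_atTop_atTop).log ha.ne'
  have hlim := (Real.tendsto_harmonic_sub_log.sub
    (Real.tendsto_harmonic_sub_log.comp hfloor)).sub hratio
  rw [sub_self, zero_sub] at hlim
  refine hlim.congr' ?_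
  filter_upwards [eventually_ne_atTop 0, hfloor.eventually_ne_atTop 0] with n hn hk
  rw [Function.comp_apply, Real.log_div (mod_cast hk) (mod_cast hn)]
  ring

theorem sum_Ico_harmonic_sub_harmonic {m n : ℕ} (hmn : m ≤ n) :
    ∑ k ∈ Finset.Ico m n, ((harmonic n : ℝ) - harmonic k) =
      n - m - m * (harmonic n - harmonic m) := by
  induction n, hmn using Nat.le_induction with
  | base => simp
  | succ n hmn ih =>
    rw [Finset.sum_Ico_succ_top hmn]
    have hinv : ((n + 1 : ℕ) : ℝ) * ((n + 1 : ℕ) : ℝ)⁻¹ = 1 := mul_inv_cancel₀ (by positivity)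
    simp only [Finset.sum_sub_distrib, Finset.sum_const, Nat.card_Ico, nsmul_eq_mul,
      harmonic_succ, Nat.cast_sub hmn] at ih ⊢
    push_cast at ih hinv ⊢
    linear_combination ih + hinv

theorem sum_min_harmonic_sub_le {m n : ℕ} (hmn : m ≤ n) :
    ∑ k ∈ Finset.range n, min 1 ((harmonic n : ℝ) - harmonic k) ≤
      n - m * (harmonic n - harmonic m) := by
  rw [← Finset.sum_range_add_sum_Ico _ hmn]
  calc _ ≤ ∑ _ ∈ Finset.range m, (1 : ℝ) +
          ∑ k ∈ Finset.Ico m n, ((harmonic n : ℝ) - harmonic k) := by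
        gcongr
        exacts [min_le_left _ _, min_le_right _ _]
    _ = n - m * (harmonic n - harmonic m) := by
        rw [sum_Ico_harmonic_sub_harmonic hmn, Finset.sum_const, Finset.card_range, nsmul_one]
        ring

theorem eventually_sum_min_harmonic_sub_lt {c : ℝ} (hc : 1 - 1 / Real.exp 1 < c) :
    ∀ᶠ n : ℕ in atTop,
      ∑ k ∈ Finset.range n, min 1 ((harmonic n : ℝ) - harmonic k) < c * n := by
  obtain ⟨a, ha⟩ : ∃ a, a = 1 / Real.exp 1 := ⟨_, rfl⟩
  have ha0 : 0 < a := by rw [ha]; positivity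
  have ha1 : a ≤ 1 := by
    rw [ha, div_le_one (Real.exp_pos 1)]
    exact Real.one_le_exp zero_le_one
  have hlog : -Real.log a = 1 := by simp [ha]
  have hratio : Tendsto (fun n : ℕ => (⌊a * n⌋₊ : ℝ) / n) atTop (𝓝 a) :=
    (tendsto_nat_floor_mul_div_atTop ha0.le).comp tendsto_natCast_atTop_atTop
  have hlim := (hratio.mul (tendsto_harmonic_sub_harmonic_floor ha0)).const_sub 1
  rw [hlog, mul_one] at hlim
  rw [← ha] at hc
  filter_upwards [hlim.eventually_lt_const hc, eventually_gt_atTop 0] with n hlt hn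
  have hfloor : ⌊a * n⌋₊ ≤ n := Nat.floor_le_of_le (mul_le_of_le_one_left n.cast_nonneg ha1)
  refine (sum_min_harmonic_sub_le hfloor).trans_lt ?_
  rw [← div_lt_iff₀ (by positivity)]
  convert hlt using 1
  field_simp

end Harmonic

section Triangular

variable {n N : ℕ}

/-- The level of a request of the triangular input: the requests arrive in `n` blocks of length `N`,
whose levels decrease from `n - 1` to `0`. -/
def level (r : Fin (n * N)) : Fin n := r.divNat.rev

theorem level_antitone : Antitone (level : Fin (n * N) → Fin n) := fun _ _ h =>
  Fin.rev_le_rev.2 (Fin.le_def.2 (Nat.div_le_div_right (Fin.le_def.1 h)))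

theorem sum_comp_level (f : Fin n → ℝ) : ∑ r : Fin (n * N), f (level r) = N * ∑ l, f l := by
  have hdiv (l : Fin n) (i : Fin N) : (finProdFinEquiv (l, i)).divNat = l :=
    congrArg Prod.fst (finProdFinEquiv.symm_apply_apply (l, i))
  rw [← finProdFinEquiv.sum_comp, Fintype.sum_prod_type]
  simp only [level, hdiv, Finset.sum_const, Finset.card_univ, Fintype.card_fin, nsmul_eq_mul,
    ← Finset.mul_sum]
  exact congrArg _ (Equiv.sum_comp Fin.revPerm f)

/-- The triangular input with the servers ranked by `σ`: a request of level `l` is adjacent to the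
`l + 1` servers of rank at most `l`, with success probability `q`. -/
abbrev triangular (q : unitInterval) (N : ℕ) (σ : Equiv.Perm (Fin n)) : Input where
  numServers := n
  numRequests := n * N
  request r s := if σ s ≤ level r then some q else none

variable (q : unitInterval) (σ : Equiv.Perm (Fin n))

theorem isEdge_triangular {s : Fin n} {r : Fin (n * N)} :
    (triangular q N σ).IsEdge s r ↔ σ s ≤ level r := by
  simp [Input.IsEdge]

theorem prob_triangular (s : Fin n) (r : Fin (n * N)) :
    (triangular q N σ).prob s r = if σ s ≤ level r then (q : ℝ) else 0 := by
  simp only [Input.prob, apply_ite fun o : Option unitInterval => o.elim 0 fun q => (q : ℝ),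
    Option.elim_some, Option.elim_none]

theorem hasEqualProb_triangular : (triangular q N σ).HasEqualProb q := fun s r h => by
  rw [prob_triangular, if_pos ((isEdge_triangular q σ).1 h)]

theorem le_opt_triangular {b : ℕ} (hNb : N * (q : ℝ) ≤ b) :
    n * (N * (q : ℝ)) ≤ (triangular q N σ).opt b := by
  have hserver (s : Fin n) :
      ∑ r : Fin (n * N) with σ.symm (level r) = s, (triangular q N σ).prob s r = N * q := by
    calc ∑ r : Fin (n * N) with σ.symm (level r) = s, (triangular q N σ).prob s r
        = ∑ r : Fin (n * N), if σ s = level r then (q : ℝ) else 0 := by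
          rw [Finset.sum_filter]
          refine Finset.sum_congr rfl fun r _ => ?_
          simp only [Equiv.symm_apply_eq, eq_comm (a := level r), prob_triangular]
          split_ifs with heq hle
          exacts [rfl, absurd heq.le hle, rfl]
      _ = N * q := by
          rw [sum_comp_level fun l => if σ s = l then (q : ℝ) else 0]
          simp
  calc n * (N * (q : ℝ))
      = ∑ r : Fin (n * N), (triangular q N σ).prob (σ.symm (level r)) r := by
        simp [prob_triangular, mul_assoc]
    _ ≤ (triangular q N σ).opt b :=
        Input.sum_prob_le_opt (G := triangular q N σ) (fun r => σ.symm (level r))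
          fun s => (hserver s).trans_le hNb

variable (b : ℕ) (A : Algorithm)

/-- The probability that the request `r` of the triangular input is matched to the server of rank
`k`, averaged over the rankings. -/
noncomputable def avgMatchProb (r : Fin (n * N)) (k : Fin n) : ℝ :=
  𝔼 σ : Equiv.Perm (Fin n), (triangular q N σ).matchProb b A r (σ.symm k)

/-- The algorithm has not yet observed which of the two servers is the server of rank `j`. -/
theorem matchProb_triangular_swap {r : Fin (n * N)} {j k : Fin n} (hj : j ≤ level r)
    (hk : k ≤ level r) (s : Fin n) :
    (triangular q N (Equiv.swap j k * σ)).matchProb b A r s =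
      (triangular q N σ).matchProb b A r s := by
  refine Input.matchProb_congr b A (fun i hi => funext fun s => ?_) s
  have hl : level r ≤ level i := level_antitone hi
  have hswap : Equiv.swap j k (σ s) ≤ level i ↔ σ s ≤ level i := by
    rw [Equiv.swap_apply_def]
    split_ifs with h₁ h₂
    · simp [h₁, hj.trans hl, hk.trans hl]
    · simp [h₂, hj.trans hl, hk.trans hl]
    · rfl
  simp only [Equiv.Perm.mul_apply, hswap]

theorem avgMatchProb_eq {r : Fin (n * N)} {j k : Fin n} (hj : j ≤ level r) (hk : k ≤ level r) :
    avgMatchProb q b A r j = avgMatchProb q b A r k := by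
  refine (Fintype.expect_equiv (Equiv.mulLeft (Equiv.swap j k)) _ _ fun σ => ?_).symm
  rw [Equiv.coe_mulLeft, matchProb_triangular_swap q σ b A hj hk]
  simp [Equiv.Perm.mul_def]

theorem avgMatchProb_eq_zero {r : Fin (n * N)} {k : Fin n} (hk : level r < k) :
    avgMatchProb q b A r k = 0 :=
  Finset.expect_eq_zero fun σ _ => Input.matchProb_eq_zero b A <| by
    rw [isEdge_triangular, Equiv.apply_symm_apply]
    exact hk.not_ge

theorem avgMatchProb_nonneg (r : Fin (n * N)) (k : Fin n) : 0 ≤ avgMatchProb q b A r k :=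
  Finset.expect_nonneg fun _ _ => Input.matchProb_nonneg ..

theorem sum_avgMatchProb_le (r : Fin (n * N)) : ∑ k, avgMatchProb q b A r k ≤ q := by
  simp only [avgMatchProb]
  rw [← Finset.expect_sum_comm]
  refine Finset.expect_le Finset.univ_nonempty fun σ _ => ?_
  rw [σ.symm.sum_comp fun s => (triangular q N σ).matchProb b A r s]
  refine Input.sum_matchProb_le (G := triangular q N σ) b A q.2.1 fun s => ?_
  rw [prob_triangular]
  split_ifs
  exacts [le_rfl, q.2.1]

theorem avgMatchProb_le (r : Fin (n * N)) {k : Fin n} (hk : k ≤ level r) :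
    avgMatchProb q b A r k ≤ q * ((level r : ℝ) + 1)⁻¹ := by
  rw [← div_eq_mul_inv, le_div_iff₀' (by positivity)]
  calc ((level r : ℝ) + 1) * avgMatchProb q b A r k
      = ∑ j ∈ Finset.Iic (level r), avgMatchProb q b A r j := by
        rw [Finset.sum_congr rfl fun j hj => avgMatchProb_eq q b A (Finset.mem_Iic.1 hj) hk]
        simp
    _ ≤ ∑ j, avgMatchProb q b A r j :=
        Finset.sum_le_univ_sum_of_nonneg fun j => avgMatchProb_nonneg q b A r j
    _ ≤ q := sum_avgMatchProb_le q b A r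

theorem sum_avgMatchProb_le_harmonic_sub (hNb : N * (q : ℝ) ≤ b) (k : Fin n) :
    ∑ r : Fin (n * N), avgMatchProb q b A r k ≤ b * (harmonic n - harmonic k) := by
  calc ∑ r : Fin (n * N), avgMatchProb q b A r k
      ≤ ∑ r : Fin (n * N), if k ≤ level r then q * ((level r : ℝ) + 1)⁻¹ else 0 := by
        refine Finset.sum_le_sum fun r _ => ?_
        split_ifs with hk
        · exact avgMatchProb_le q b A r hk
        · exact (avgMatchProb_eq_zero q b A (not_le.1 hk)).le
    _ = N * q * ∑ l ∈ Finset.Ici k, ((l : ℝ) + 1)⁻¹ := by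
        rw [sum_comp_level fun l => if k ≤ l then q * ((l : ℝ) + 1)⁻¹ else 0,
          ← Finset.sum_filter, Finset.filter_le_eq_Ici, ← Finset.mul_sum, mul_assoc]
    _ ≤ b * ∑ l ∈ Finset.Ici k, ((l : ℝ) + 1)⁻¹ := by gcongr
    _ = b * (harmonic n - harmonic k) := by rw [sum_Ici_inv_eq_harmonic_sub]

theorem sum_avgMatchProb_le_capacity (k : Fin n) :
    ∑ r : Fin (n * N), avgMatchProb q b A r k ≤ b := by
  simp only [avgMatchProb]
  rw [← Finset.expect_sum_comm]
  exact Finset.expect_le Finset.univ_nonempty fun σ _ =>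
    (triangular q N σ).sum_matchProb_le_capacity b A (σ.symm k)

theorem expect_expectedMatches_triangular :
    𝔼 σ : Equiv.Perm (Fin n), expectedMatches b A (triangular q N σ) =
      ∑ k, ∑ r : Fin (n * N), avgMatchProb q b A r k := by
  rw [Finset.sum_comm]
  simp only [avgMatchProb, ← Finset.expect_sum_comm]
  refine Finset.expect_congr rfl fun σ _ => ?_
  rw [Input.expectedMatches_eq_sum_matchProb]
  exact Finset.sum_congr rfl fun r _ => (σ.symm.sum_comp _).symm

theorem expect_expectedMatches_triangular_le (hNb : N * (q : ℝ) ≤ b) :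
    𝔼 σ : Equiv.Perm (Fin n), expectedMatches b A (triangular q N σ) ≤
      b * ∑ k ∈ Finset.range n, min 1 ((harmonic n : ℝ) - harmonic k) := by
  rw [expect_expectedMatches_triangular, Finset.mul_sum, ← Fin.sum_univ_eq_sum_range
    fun k => (b : ℝ) * min 1 ((harmonic n : ℝ) - harmonic k)]
  refine Finset.sum_le_sum fun k _ => ?_
  rw [mul_min_of_nonneg _ _ b.cast_nonneg, mul_one]
  exact le_min (sum_avgMatchProb_le_capacity q b A k)
    (sum_avgMatchProb_le_harmonic_sub q b A hNb k)

variable {q b A} in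
theorem IsCompetitiveOn.le_sum_min_harmonic_sub {c : ℝ}
    (hA : IsCompetitiveOn {G | G.HasEqualProb q} b c A) (hc : 0 ≤ c) (hNb : N * (q : ℝ) ≤ b) :
    c * (n * (N * q)) ≤ b * ∑ k ∈ Finset.range n, min 1 ((harmonic n : ℝ) - harmonic k) := by
  refine le_trans ?_ (expect_expectedMatches_triangular_le q b A hNb)
  refine Finset.le_expect Finset.univ_nonempty fun σ _ => ?_
  exact (mul_le_mul_of_nonneg_left (le_opt_triangular q σ hNb) hc).trans
    (hA _ (hasEqualProb_triangular q σ))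

end Triangular

end OnlineBMatching

theorem mainTheorem2 (b : ℕ) (hb : 1 ≤ b) (c : ℝ) (hc : 1 - 1 / Real.exp 1 < c) :
    ∀ᶠ p : ℝ in 𝓝[>] 0, ∀ A : OnlineBMatching.Algorithm,
      ¬ OnlineBMatching.IsCompetitiveOn {G | G.HasEqualProb p} b c A := by
  have hb₀ : (0 : ℝ) < b := by positivity
  have hc₀ : 0 ≤ c := by
    have : 1 / Real.exp 1 ≤ 1 := (div_le_one (Real.exp_pos 1)).2 (Real.one_le_exp zero_le_one)
    linarith
  obtain ⟨n, hn⟩ := (OnlineBMatching.eventually_sum_min_harmonic_sub_lt hc).exists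
  have hlim : Tendsto (fun p : ℝ => c * (n * (⌊(b : ℝ) * p⁻¹⌋₊ * p))) (𝓝[>] 0)
      (𝓝 (c * (n * b))) := by
    have := (tendsto_nat_floor_mul_div_atTop hb₀.le).comp (tendsto_inv_nhdsGT_zero (𝕜 := ℝ))
    simp only [Function.comp_def, div_inv_eq_mul] at this
    exact (this.const_mul _).const_mul _
  have hgap : b * ∑ k ∈ Finset.range n, min 1 ((harmonic n : ℝ) - harmonic k) < c * (n * b) := by
    linarith [mul_lt_mul_of_pos_left hn hb₀]
  filter_upwards [hlim.eventually_const_lt hgap, Ioo_mem_nhdsGT one_pos]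
    with p hp ⟨hp₀, hp₁⟩ A hA
  have hfloor : (⌊(b : ℝ) * p⁻¹⌋₊ : ℝ) * p ≤ b := by
    rw [← le_mul_inv_iff₀ hp₀]
    exact Nat.floor_le (by positivity)
  exact hp.not_ge (hA.le_sum_min_harmonic_sub (q := ⟨p, hp₀.le, hp₁.le⟩) hc₀ hfloor)
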